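/- Let $n\ge 1$ and let $\mathcal B$ be the collection of all open cubes in $\mathbb R^n$ with sides parallel to the coordinate axes. For $f:\mathbb R^n\to\mathbb R$ let $$M_{\mathrm{HL},c}f(x)=\sup_{x\in R\in\mathcal B}\frac1{|R|}\int_R|f|$$ be the uncentered Hardy–Littlewood maximal operator with respect to cubes, where $|\cdot|$ is Lebesgue measure, and let $\phi_{\mathrm{HL},c}$ be its halo function, that is, $\phi_{\mathrm{HL},c}(\alpha)=\alpha$ for $0\le\alpha\le1$ and $$\phi_{\mathrm{HL},c}(\alpha)=\sup_{E}\frac{1}{|E|}\,\bigl|\{x\in\mathbb R^n: M_{\mathrm{HL},c}\chi_E(x)>1/\alpha\}\bigr|\qquad(\alpha>1),$$ the supremum being over all Lebesgue measurable $E\subset\mathbb R^n$ with $0<|E|<\infty$. Then $\phi_{\mathrm{HL},c}$ is finite on $[0,\infty)$ and $\phi_{\mathrm{HL},c}\in C^{1/n}([0,\infty))$: for every compact set $K\subset[0,\infty)$ there is a constant $C$ such that $$|\phi_{\mathrm{HL},c}(x)-\phi_{\mathrm{HL},c}(y)|\le C\,|x-y|^{1/n}\qquad\text{for all }x,y\in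 K.$$ -/

import Mathlib

open MeasureTheory
open scoped ENNReal NNReal

namespace GeomMax

/-- The basis of all (nondegenerate, open) cubes in `ℝⁿ` with sides parallel to the coordinate
axes. Here `ℝⁿ` is `Fin n → ℝ`, whose `volume` is Lebesgue measure. -/
def cubes (n : ℕ) : Set (Set (Fin n → ℝ)) :=
  {R | ∃ (a : Fin n → ℝ) (l : ℝ), 0 < l ∧ R = Set.pi Set.univ (fun i => Set.Ioo (a i) (a i + l))}

/-- The (uncentered) maximal operator of a basis `B`: the supremum of the averages of `|f|` over
all `R ∈ B` containing `x`; it is `0` when no member of `B` contains `x`. -/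
noncomputable def maximalFunction {n : ℕ} (B : Set (Set (Fin n → ℝ))) (f : (Fin n → ℝ) → ℝ)
    (x : Fin n → ℝ) : ℝ≥0∞ :=
  ⨆ R ∈ {R ∈ B | x ∈ R}, (∫⁻ y in R, ‖f y‖ₑ) / volume R

/-- The halo set `{x : M_B χ_E (x) > t}`. -/
def haloSet {n : ℕ} (B : Set (Set (Fin n → ℝ))) (t : ℝ) (E : Set (Fin n → ℝ)) :
    Set (Fin n → ℝ) :=
  {x | ENNReal.ofReal t < maximalFunction B (E.indicator (fun _ => (1 : ℝ))) x}

/-- The halo function of a basis `B`, with values in `[0, ∞]`: for `1 < a` it is the supremum of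
`|{M_B χ_E > 1 / a}| / |E|` over all Lebesgue measurable `E` with `0 < |E| < ∞`, and it is `a`
for `0 ≤ a ≤ 1`. (Only arguments `0 ≤ a` are meaningful.) -/
noncomputable def haloFunction {n : ℕ} (B : Set (Set (Fin n → ℝ))) (a : ℝ) : ℝ≥0∞ :=
  if a ≤ 1 then ENNReal.ofReal a
  else ⨆ E ∈ {E : Set (Fin n → ℝ) | NullMeasurableSet E volume ∧ 0 < volume E ∧ volume E < ∞},
    volume (haloSet B (1 / a) E) / volume E

/-- The (local) Hölder class `C^p(I)`: for every compact `K ⊆ I` there is a constant `C` with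
`|f x - f y| ≤ C * |x - y| ^ p` for all `x, y ∈ K`. -/
def HolderClass (p : ℝ≥0) (I : Set ℝ) (f : ℝ → ℝ) : Prop :=
  ∀ K : Set ℝ, IsCompact K → K ⊆ I → ∃ C : ℝ≥0, HolderOnWith C p f K

end GeomMax

/-! Write φ for the halo function. The heart is the growth bound `haloFunction_mul_le`: φ(κa) ≤ (1 +
4ε)^n φ(a) for a ≥ 1, where κ = 1 + ε^n / (2·4^n). Given E, Solyanik's estimate (`exists_halo`)
yields E' with |E'| ≤ (1 + 4ε)^n |E| that contains every cube in which E misses a proportion less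
than δ = ε^n. In any other cube the density of E' is at least κ times that of E
(`mul_volume_inter_closedBall_le`): almost every point of E there lies in a subcube missing exactly
the proportion δ/2. Such subcubes lie in E', and a Vitali selection of them bounds the gain from
below. So for a > 1 the halo set of E at level 1/(κa) lies in that of E' at level 1/a. Iterating
from φ(1) = 1 gives finiteness. Since ε is comparable to (κ - 1)^(1/n), the same bound gives the
exponent 1/n. -/

namespace GeomMax

/-! ### Solyanik's estimate on the line -/

/-- An irredundant finite family of intervals covers each point at most twice. -/
lemma exists_subfamily_iUnion_Ioo_eq (s : Finset (ℝ × ℝ)) :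
    ∃ t ⊆ s, (⋃ p ∈ t, Set.Ioo p.1 p.2) = (⋃ p ∈ s, Set.Ioo p.1 p.2) ∧
      ∀ x : ℝ, (t.filter (fun p => x ∈ Set.Ioo p.1 p.2)).card ≤ 2 := by
  classical
  induction s using Finset.strongInduction with
  | H s ih =>
  by_cases h : ∃ r ∈ s, Set.Ioo r.1 r.2 ⊆ ⋃ p ∈ s.erase r, Set.Ioo p.1 p.2
  · obtain ⟨r, hr, hsub⟩ := h
    obtain ⟨t, hts, hU, hc⟩ := ih _ (Finset.erase_ssubset hr)
    refine ⟨t, hts.trans (Finset.erase_subset _ _), hU.trans ?_, hc⟩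
    apply subset_antisymm
    · exact Set.biUnion_subset_biUnion_left (Finset.erase_subset r s)
    · refine Set.iUnion₂_subset fun p hp => ?_
      by_cases hpr : p = r
      · exact hpr ▸ hsub
      · exact Set.subset_biUnion_of_mem (u := fun p : ℝ × ℝ => Set.Ioo p.1 p.2)
          (Finset.mem_erase.2 ⟨hpr, hp⟩)
  · push Not at h
    refine ⟨s, subset_rfl, rfl, fun x => ?_⟩
    by_contra! hcard
    set F := s.filter (fun p => x ∈ Set.Ioo p.1 p.2) with hF
    have hne : F.Nonempty := Finset.card_pos.1 (by omega)
    -- Among the intervals containing `x`, the one reaching furthest left and the one reaching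
    -- furthest right together cover all the others, so a third would be redundant.
    obtain ⟨p, hp, hpmin⟩ := F.exists_min_image (fun p => p.1) hne
    obtain ⟨q, hq, hqmax⟩ := F.exists_max_image (fun p => p.2) hne
    obtain ⟨r, hr, hrn⟩ : ∃ r ∈ F, r ∉ ({p, q} : Finset (ℝ × ℝ)) := by
      by_contra! hcon
      exact absurd ((Finset.card_le_card hcon).trans Finset.card_le_two) (by omega)
    simp only [Finset.mem_insert, Finset.mem_singleton, not_or] at hrn
    have hrp := hpmin r hr
    have hrq := hqmax r hr
    rw [hF, Finset.mem_filter] at hp hq hr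
    refine h r hr.1 fun y hy => ?_
    rcases le_or_gt y x with hyx | hyx
    · exact Set.mem_biUnion (Finset.mem_coe.2 (Finset.mem_erase.2 ⟨Ne.symm hrn.1, hp.1⟩))
        ⟨hrp.trans_lt hy.1, hyx.trans_lt hp.2.2⟩
    · exact Set.mem_biUnion (Finset.mem_coe.2 (Finset.mem_erase.2 ⟨Ne.symm hrn.2, hq.1⟩))
        ⟨hq.2.1.trans hyx, hy.2.trans_le hrq⟩

lemma sum_volume_Ioo_le_of_card_le (t : Finset (ℝ × ℝ))
    (ht : ∀ x : ℝ, (t.filter (fun p => x ∈ Set.Ioo p.1 p.2)).card ≤ 2) :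
    ∑ p ∈ t, volume (Set.Ioo p.1 p.2) ≤ 2 * volume (⋃ p ∈ t, Set.Ioo p.1 p.2) := by
  classical
  have hU : MeasurableSet (⋃ p ∈ t, Set.Ioo p.1 p.2) :=
    Finset.measurableSet_biUnion _ fun _ _ => measurableSet_Ioo
  calc ∑ p ∈ t, volume (Set.Ioo p.1 p.2)
      = ∫⁻ x, ∑ p ∈ t, (Set.Ioo p.1 p.2).indicator 1 x := by
        rw [lintegral_finsetSum _ fun p _ => measurable_one.indicator measurableSet_Ioo]
        simp only [lintegral_indicator_one measurableSet_Ioo]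
    _ ≤ ∫⁻ x, 2 * (⋃ p ∈ t, Set.Ioo p.1 p.2).indicator 1 x := by
        refine lintegral_mono fun x => ?_
        simp only [Set.indicator_apply, Pi.one_apply, Finset.sum_boole]
        split_ifs with hx
        · rw [mul_one]; exact_mod_cast ht x
        · rw [Finset.filter_false_of_mem]
          · simp
          · intro p hp hxp
            exact hx (Set.mem_biUnion (Finset.mem_coe.2 hp) hxp)
    _ = 2 * volume (⋃ p ∈ t, Set.Ioo p.1 p.2) := by
        rw [lintegral_const_mul _ (measurable_one.indicator hU), lintegral_indicator_one hU]

/-- A finite union of intervals almost filled by `A` is not much larger than `A`. -/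
lemma volume_biUnion_Ioo_le {ε : ℝ≥0} (hε : ε ≤ 1 / 4) (A : Set ℝ) (s : Finset (ℝ × ℝ))
    (hs : ∀ p ∈ s, volume (Set.Ioo p.1 p.2 \ A) ≤ ε * volume (Set.Ioo p.1 p.2)) :
    volume (⋃ p ∈ s, Set.Ioo p.1 p.2) ≤ (1 + 4 * ε) * volume A := by
  obtain ⟨t, hts, hU, hc⟩ := exists_subfamily_iUnion_Ioo_eq s
  rw [← hU]
  set U := ⋃ p ∈ t, Set.Ioo p.1 p.2 with hUdef
  have hfin : volume U ≠ ∞ := by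
    refine ((measure_biUnion_finset_le t _).trans_lt ?_).ne
    exact ENNReal.sum_lt_top.2 fun p _ => by simp
  have h1 : volume (U \ A) ≤ 2 * ε * volume U := by
    calc volume (U \ A) = volume (⋃ p ∈ t, Set.Ioo p.1 p.2 \ A) := by
          simp only [hUdef, Set.iUnion_sdiff]
      _ ≤ ∑ p ∈ t, volume (Set.Ioo p.1 p.2 \ A) := measure_biUnion_finset_le t _
      _ ≤ ∑ p ∈ t, ε * volume (Set.Ioo p.1 p.2) := Finset.sum_le_sum fun p hp => hs p (hts hp)
      _ ≤ ε * (2 * volume U) := by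
          rw [← Finset.mul_sum]
          gcongr
          exact sum_volume_Ioo_le_of_card_le t hc
      _ = 2 * ε * volume U := by ring
  rcases eq_or_ne (volume A) ∞ with hA | hA
  · rw [hA, ENNReal.mul_top (by simp)]; exact le_top
  have h2 : volume U ≤ volume A + 2 * ε * volume U :=
    (measure_mono (t := A ∪ U \ A) (by simp)).trans ((measure_union_le _ _).trans (by gcongr))
  lift volume U to ℝ≥0 using hfin with u
  lift volume A to ℝ≥0 using hA with a
  norm_cast at h2 ⊢
  have h2' : (u : ℝ) ≤ a + 2 * ε * u := by exact_mod_cast h2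
  have hε' : (ε : ℝ) ≤ 1 / 4 := by exact_mod_cast hε
  -- Here `u * (1 - 2ε) ≤ a`, and `(1 + 4ε)(1 - 2ε) ≥ 1` because `0 ≤ ε ≤ 1 / 4`.
  have : (u : ℝ) ≤ (1 + 4 * ε) * a := by
    have h0 : (0 : ℝ) ≤ ε := ε.2
    have hu : (0 : ℝ) ≤ u := u.2
    nlinarith [mul_nonneg (mul_nonneg h0 hu) (sub_nonneg.2 hε')]
  exact_mod_cast this

/-! ### Solyanik's estimate in all dimensions, one coordinate at a time -/

/-- The fibrewise union of all rational intervals in which `E` has density more than `1 - ε`. -/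
def lineHalo {P : Type*} (ε : ℝ≥0) (E : Set (P × ℝ)) : Set (P × ℝ) :=
  ⋃ r : ℚ × ℚ, {x | volume (Set.Ioo (r.1 : ℝ) r.2 \ (Prod.mk x ⁻¹' E)) <
    ε * volume (Set.Ioo (r.1 : ℝ) r.2)} ×ˢ Set.Ioo (r.1 : ℝ) r.2

/-- Rational endpoints make the halo a countable union of measurable rectangles. -/
lemma measurableSet_lineHalo {P : Type*} [MeasurableSpace P] (ε : ℝ≥0) {E : Set (P × ℝ)} (hE : MeasurableSet E) :
    MeasurableSet (lineHalo ε E) := by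
  refine MeasurableSet.iUnion fun r => MeasurableSet.prod ?_ measurableSet_Ioo
  refine measurableSet_lt ?_ measurable_const
  exact measurable_measure_prodMk_left
    (s := (Prod.snd ⁻¹' Set.Ioo (r.1 : ℝ) r.2) \ E) ((measurable_snd measurableSet_Ioo).diff hE)

lemma volume_lineHalo_le {P : Type*} {ε : ℝ≥0} (hε : ε ≤ 1 / 4) (E : Set (P × ℝ)) (x : P) :
    volume (Prod.mk x ⁻¹' lineHalo ε E) ≤ (1 + 4 * ε) * volume (Prod.mk x ⁻¹' E) := by
  classical
  set A := Prod.mk x ⁻¹' E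
  let T : Set (ℚ × ℚ) := {r | volume (Set.Ioo (r.1 : ℝ) r.2 \ A) <
    ε * volume (Set.Ioo (r.1 : ℝ) r.2)}
  have h : Prod.mk x ⁻¹' lineHalo ε E = ⋃ r : T, Set.Ioo (r.1.1 : ℝ) r.1.2 := by
    ext t
    simp only [lineHalo, Set.preimage_iUnion, Set.mem_iUnion, Set.mem_preimage, Set.mem_prod,
      Subtype.exists, exists_prop, T, A]
    rfl
  -- By continuity from below, the bound for finite families passes to the countable one.
  rw [h, Set.iUnion_eq_iUnion_finset, Directed.measure_iUnion]
  · refine iSup_le fun F => ?_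
    have := volume_biUnion_Ioo_le hε A (F.image fun r : T => ((r.1.1 : ℝ), (r.1.2 : ℝ))) (by
      intro p hp
      obtain ⟨r, -, rfl⟩ := Finset.mem_image.1 hp
      exact r.2.le)
    rwa [Finset.set_biUnion_finset_image] at this
  · exact Monotone.directed_le fun F G hFG => Set.biUnion_subset_biUnion_left hFG

/-- The strict inequality leaves slack, which pays for enlarging the interval to an open one with
rational endpoints. -/
lemma Icc_subset_lineHalo {P : Type*} {ε : ℝ≥0} {E : Set (P × ℝ)} {x : P} {a b : ℝ}
    (h : volume (Set.Icc a b \ (Prod.mk x ⁻¹' E)) < ε * volume (Set.Icc a b)) :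
    Set.Icc a b ⊆ Prod.mk x ⁻¹' lineHalo ε E := by
  set A := Prod.mk x ⁻¹' E
  intro t ht
  have hab : a ≤ b := ht.1.trans ht.2
  have hfin : volume (Set.Icc a b \ A) ≠ ∞ := (h.trans_le le_top).ne
  have hv : (volume (Set.Icc a b \ A)).toReal < ε * (b - a) := by
    rw [Real.volume_Icc] at h
    have := (ENNReal.toReal_lt_toReal hfin (by finiteness)).2 h
    rwa [ENNReal.toReal_mul, ENNReal.toReal_ofReal (by linarith), ENNReal.coe_toReal] at this
  set v := (volume (Set.Icc a b \ A)).toReal with hvdef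
  obtain ⟨p, hp1, hp2⟩ := exists_rat_btwn (show a - (ε * (b - a) - v) / 2 < a by linarith)
  obtain ⟨q, hq1, hq2⟩ := exists_rat_btwn (show b < b + (ε * (b - a) - v) / 2 by linarith)
  refine Set.mem_iUnion.2 ⟨(p, q), ?_, hp2.trans_le ht.1, ht.2.trans_lt hq1⟩
  simp only [Set.mem_ofPred_eq]
  have hsub : Set.Ioo (p : ℝ) q \ A ⊆ (Set.Icc a b \ A) ∪ (Set.Ico (p : ℝ) a ∪ Set.Ioc b q) := by
    rintro y ⟨⟨hy1, hy2⟩, hyA⟩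
    by_cases h1 : y < a
    · exact Or.inr (Or.inl ⟨hy1.le, h1⟩)
    by_cases h2 : b < y
    · exact Or.inr (Or.inr ⟨h2, hy2.le⟩)
    · exact Or.inl ⟨⟨not_lt.1 h1, not_lt.1 h2⟩, hyA⟩
  calc volume (Set.Ioo (p : ℝ) q \ A)
      ≤ volume (Set.Icc a b \ A) + (volume (Set.Ico (p : ℝ) a) + volume (Set.Ioc b (q : ℝ))) :=
        (measure_mono hsub).trans ((measure_union_le _ _).trans
          (by gcongr; exact measure_union_le _ _))
    _ = ENNReal.ofReal (v + ((a - p) + (q - b))) := by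
        rw [Real.volume_Ico, Real.volume_Ioc, ENNReal.ofReal_add ENNReal.toReal_nonneg
          (by linarith), ENNReal.ofReal_add (by linarith) (by linarith), ENNReal.ofReal_toReal hfin]
    _ < ENNReal.ofReal (ε * (q - p)) := by
        have h0 : (0 : ℝ) ≤ ε := ε.2
        have h1 : (ε : ℝ) * (b - a) ≤ ε * (q - p) := by gcongr
        refine (ENNReal.ofReal_lt_ofReal_iff_of_nonneg ?_).2 (by linarith)
        have : 0 ≤ v := ENNReal.toReal_nonneg
        linarith
    _ = ε * volume (Set.Ioo (p : ℝ) q) := by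
        rw [Real.volume_Ioo, ENNReal.ofReal_mul ε.coe_nonneg, ENNReal.ofReal_coe_nnreal]

/-- Induction on the dimension: fatten along the first coordinate, then treat that coordinate as a
parameter and fatten in the others. This is why a parameter space `P` is carried and generalized.
The volume factors multiply by Tonelli. -/
theorem exists_fiberwise_halo {ε : ℝ≥0} (hε : ε ≤ 1 / 4) (n : ℕ) {P : Type}
    [MeasurableSpace P] {E : Set (P × (Fin n → ℝ))} (hE : MeasurableSet E) :
    ∃ E' : Set (P × (Fin n → ℝ)), MeasurableSet E' ∧
      (∀ p, volume (Prod.mk p ⁻¹' E') ≤ (1 + 4 * ε) ^ n * volume (Prod.mk p ⁻¹' E)) ∧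
      ∀ p a b, volume (Set.Icc a b \ (Prod.mk p ⁻¹' E)) < ε ^ n * volume (Set.Icc a b) →
        Set.Icc a b ⊆ Prod.mk p ⁻¹' E' := by
  induction n generalizing P with
  | zero =>
    refine ⟨E, hE, fun p => by simp, fun p a b h => ?_⟩
    intro x hx
    by_contra hxE
    have : Set.Icc a b \ (Prod.mk p ⁻¹' E) = Set.Icc a b := by
      ext y
      rw [Subsingleton.elim y x]
      exact ⟨fun h => h.1, fun h => ⟨h, hxE⟩⟩
    rw [this, pow_zero, one_mul] at h
    exact lt_irrefl _ h
  | succ n ih =>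
    let e : (Fin (n + 1) → ℝ) ≃ᵐ ℝ × (Fin n → ℝ) :=
      MeasurableEquiv.piFinSuccAbove (fun _ => ℝ) 0
    have he : MeasurePreserving e := volume_preserving_piFinSuccAbove (fun _ => ℝ) 0
    let F : Set ((P × (Fin n → ℝ)) × ℝ) := {z | (z.1.1, e.symm (z.2, z.1.2)) ∈ E}
    have hF : MeasurableSet F := by
      have : Measurable fun z : (P × (Fin n → ℝ)) × ℝ => (z.1.1, e.symm (z.2, z.1.2)) := by
        fun_prop
      exact this hE
    let G : Set ((P × ℝ) × (Fin n → ℝ)) := {z | ((z.1.1, z.2), z.1.2) ∈ lineHalo ε F}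
    have hG : MeasurableSet G := by
      have : Measurable fun z : (P × ℝ) × (Fin n → ℝ) => ((z.1.1, z.2), z.1.2) := by fun_prop
      exact this (measurableSet_lineHalo ε hF)
    obtain ⟨G', hG', hvol, hbox⟩ := ih hG
    let S : P → Set (ℝ × (Fin n → ℝ)) := fun p => e.symm ⁻¹' (Prod.mk p ⁻¹' E)
    have hS : ∀ p, MeasurableSet (S p) := fun p =>
      e.symm.measurable (measurable_prodMk_left hE)
    have hSvol : ∀ T : Set (ℝ × (Fin n → ℝ)),
        volume (e ⁻¹' T) = (volume.prod volume) T := fun T => he.measure_preimage_equiv T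
    refine ⟨{z | ((z.1, (e z.2).1), (e z.2).2) ∈ G'}, ?_, fun p => ?_, fun p a b h => ?_⟩
    · have : Measurable fun z : P × (Fin (n + 1) → ℝ) => ((z.1, (e z.2).1), (e z.2).2) := by
        fun_prop
      exact this hG'
    · have hT' : MeasurableSet {z : ℝ × (Fin n → ℝ) | ((p, z.1), z.2) ∈ G'} := by
        have : Measurable fun z : ℝ × (Fin n → ℝ) => ((p, z.1), z.2) := by fun_prop
        exact this hG'
      have hT : MeasurableSet {z : ℝ × (Fin n → ℝ) | ((p, z.1), z.2) ∈ G} := by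
        have : Measurable fun z : ℝ × (Fin n → ℝ) => ((p, z.1), z.2) := by fun_prop
        exact this hG
      calc volume (e ⁻¹' {z | ((p, z.1), z.2) ∈ G'})
          = ∫⁻ t, volume (Prod.mk (p, t) ⁻¹' G') := by
            rw [hSvol, Measure.prod_apply hT']; rfl
        _ ≤ ∫⁻ t, (1 + 4 * ε) ^ n * volume (Prod.mk (p, t) ⁻¹' G) :=
            lintegral_mono fun t => hvol (p, t)
        _ = (1 + 4 * ε) ^ n * (volume.prod volume) {z | ((p, z.1), z.2) ∈ G} := by
            rw [Measure.prod_apply hT, lintegral_const_mul' _ _ (by finiteness)]; rfl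
        _ = (1 + 4 * ε) ^ n * ∫⁻ x, volume (Prod.mk (p, x) ⁻¹' lineHalo ε F) := by
            rw [Measure.prod_apply_symm hT]; rfl
        _ ≤ (1 + 4 * ε) ^ n * ∫⁻ x, (1 + 4 * ε) * volume (Prod.mk (p, x) ⁻¹' F) := by
            gcongr with x
            exact volume_lineHalo_le hε F (p, x)
        _ = (1 + 4 * ε) ^ (n + 1) * (volume.prod volume) (S p) := by
            rw [Measure.prod_apply_symm (hS p), lintegral_const_mul' _ _ (by finiteness),
              ← mul_assoc, pow_succ]
            rfl
        _ = (1 + 4 * ε) ^ (n + 1) * volume (Prod.mk p ⁻¹' E) := by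
            rw [← hSvol]
            congr 2
            ext z
            simp [S]
    · set I := Set.Icc (a 0) (b 0)
      set R := Set.Icc (fun i : Fin n => a i.succ) (fun i => b i.succ)
      have hIR : Set.Icc a b = e ⁻¹' (I ×ˢ R) := by
        ext z
        simp only [Set.mem_preimage, Set.mem_prod, I, R, Set.mem_Icc, Pi.le_def, Fin.forall_fin_succ]
        constructor
        · rintro ⟨⟨h1, h2⟩, h3, h4⟩; exact ⟨⟨h1, h3⟩, h2, h4⟩
        · rintro ⟨⟨h1, h3⟩, h2, h4⟩; exact ⟨⟨h1, h2⟩, h3, h4⟩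
      have hdiff : Set.Icc a b \ (Prod.mk p ⁻¹' E) = e ⁻¹' ((I ×ˢ R) \ S p) := by
        rw [hIR]
        ext z
        simp [S]
      have hmI : MeasurableSet I := measurableSet_Icc
      have hmR : MeasurableSet R := measurableSet_Icc
      rw [hdiff, hIR, hSvol, hSvol, Measure.prod_prod,
        Measure.prod_apply_symm ((hmI.prod hmR).diff (hS p))] at h
      let g : (Fin n → ℝ) → ℝ≥0∞ := fun x => volume (I \ (Prod.mk (p, x) ⁻¹' F))
      -- The bad lines in the first direction, where `E` misses at least the proportion `ε`. By
      -- Chebyshev they occupy less than `ε ^ n` of the base `R`; all other lines are filled by `G`,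
      -- so every slice of `G` over `t ∈ I` meets the induction hypothesis.
      let B := {x | ε * volume I ≤ (R.indicator g) x}
      have hBB : ε * volume I * volume B < ε * volume I * (ε ^ n * volume R) := by
        calc ε * volume I * volume B ≤ ∫⁻ x, R.indicator g x :=
            mul_meas_ge_le_lintegral₀ (Measurable.aemeasurable (by
              refine Measurable.indicator ?_ hmR
              refine measurable_measure_prodMk_left
                (s := {z : (Fin n → ℝ) × ℝ | z.2 ∈ I ∧ ((p, z.1), z.2) ∉ F}) ?_
              refine (measurable_snd hmI).inter (MeasurableSet.compl ?_)
              have : Measurable fun z : (Fin n → ℝ) × ℝ => ((p, z.1), z.2) := by fun_prop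
              exact this hF)) _
          _ = ∫⁻ x, volume ((fun t => (t, x)) ⁻¹' (I ×ˢ R \ S p)) := by
            refine lintegral_congr fun x => ?_
            by_cases hx : x ∈ R
            · rw [Set.indicator_of_mem hx]
              refine congrArg volume ?_
              ext t
              simp [hx, S, F]
            · rw [Set.indicator_of_notMem hx]
              have : (fun t => (t, x)) ⁻¹' (I ×ˢ R \ S p) = ∅ := by
                ext t
                simp [hx]
              rw [this, measure_empty]
          _ < ε ^ (n + 1) * (volume I * volume R) := h
          _ = ε * volume I * (ε ^ n * volume R) := by ring
      have hB : volume B < ε ^ n * volume R := lt_of_mul_lt_mul_left' hBB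
      have key : ∀ t ∈ I, R ⊆ Prod.mk (p, t) ⁻¹' G' := by
        intro t ht
        refine hbox (p, t) _ _ (lt_of_le_of_lt (measure_mono ?_) hB)
        rintro x ⟨hxR, hxG⟩
        by_contra hxB
        refine hxG ?_
        have h1 : g x < ε * volume I := by
          have : R.indicator g x < ε * volume I := not_le.1 hxB
          rwa [Set.indicator_of_mem hxR] at this
        exact Icc_subset_lineHalo h1 ht
      rw [hIR]
      intro z hz
      exact key _ hz.1 hz.2

/-- **Solyanik's estimate.** Every measurable `E` is contained, up to the cubes in which it is not
almost full, in a set of comparable measure. -/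
theorem exists_halo {ε : ℝ≥0} (hε : ε ≤ 1 / 4) {n : ℕ} {E : Set (Fin n → ℝ)}
    (hE : MeasurableSet E) :
    ∃ E' : Set (Fin n → ℝ), MeasurableSet E' ∧
      volume E' ≤ (1 + 4 * ε) ^ n * volume E ∧
      ∀ a b, volume (Set.Icc a b \ E) < ε ^ n * volume (Set.Icc a b) → Set.Icc a b ⊆ E' := by
  obtain ⟨E', h1, h2, h3⟩ := exists_fiberwise_halo hε n (P := Unit) (measurable_snd hE)
  exact ⟨Prod.mk () ⁻¹' E', measurable_prodMk_left h1, h2 (), h3 ()⟩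

/-! ### Density gain in cubes that are not almost full -/

lemma closedBall_pi_eq_Icc {n : ℕ} (w : Fin n → ℝ) {r : ℝ} (hr : 0 ≤ r) :
    Metric.closedBall w r = Set.Icc (fun i => w i - r) (fun i => w i + r) := by
  rw [closedBall_pi w hr, ← Set.pi_univ_Icc]
  simp only [Real.closedBall_eq_Icc]

/-- For `s ≥ 0` these balls are the images of `closedBall w r` under homotheties centred at its
point `x`, hence nested. -/
lemma closedBall_lineMap_subset {n : ℕ} {x w : Fin n → ℝ} {r s s' : ℝ}
    (hx : x ∈ Metric.closedBall w r) (hss' : s ≤ s') :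
    Metric.closedBall (AffineMap.lineMap x w s) (s * r) ⊆
      Metric.closedBall (AffineMap.lineMap x w s') (s' * r) := by
  refine Metric.closedBall_subset_closedBall' ?_
  rw [dist_lineMap_lineMap, Real.dist_eq, abs_of_nonpos (by linarith)]
  have : (s' - s) * dist x w ≤ (s' - s) * r :=
    mul_le_mul_of_nonneg_left (Metric.mem_closedBall.1 hx) (by linarith)
  linarith

lemma volume_closedBall_mul {n : ℕ} (w w' : Fin n → ℝ) {r s : ℝ} (hr : 0 ≤ r) (hs : 0 ≤ s) :
    volume (Metric.closedBall w (s * r)) =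
      ENNReal.ofReal (s ^ n) * volume (Metric.closedBall w' r) := by
  rw [Real.volume_pi_closedBall _ (by positivity), Real.volume_pi_closedBall _ hr,
    ← ENNReal.ofReal_mul (by positivity), Fintype.card_fin]
  congr 1
  ring

/-- By nesting, the increments are dominated by those of the full volume `(2 * (s * r)) ^ n`, which
is continuous. -/
lemma continuousOn_volume_lineMap_diff {n : ℕ} {x w : Fin n → ℝ} {r : ℝ} (hr : 0 ≤ r)
    (hx : x ∈ Metric.closedBall w r) (E : Set (Fin n → ℝ)) :
    ContinuousOn (fun s : ℝ =>
      (volume (Metric.closedBall (AffineMap.lineMap x w s) (s * r) \ E)).toReal) (Set.Ici 0) := by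
  set Q : ℝ → Set (Fin n → ℝ) := fun s => Metric.closedBall (AffineMap.lineMap x w s) (s * r)
  set g : ℝ → ℝ := fun s => (2 * (s * r)) ^ n
  have hQ : ∀ s, 0 ≤ s → volume (Q s) = ENNReal.ofReal (g s) := fun s hs => by
    simp only [Q, g]
    rw [Real.volume_pi_closedBall _ (by positivity), Fintype.card_fin]
  have hfin : ∀ s, 0 ≤ s → volume (Q s) ≠ ∞ := fun s hs => by rw [hQ s hs]; finiteness
  have hfin' : ∀ s, 0 ≤ s → volume (Q s \ E) ≠ ∞ := fun s hs =>
    ((measure_mono Set.sdiff_subset).trans_lt (hfin s hs).lt_top).ne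
  have hdist : ∀ s, 0 ≤ s → ∀ s', s ≤ s' →
      dist (volume (Q s \ E)).toReal (volume (Q s' \ E)).toReal ≤ dist (g s) (g s') := by
    intro s hs s' hss'
    have hs' := hs.trans hss'
    have hsub : Q s ⊆ Q s' := closedBall_lineMap_subset hx hss'
    have hg : g s ≤ g s' := by simp only [g]; gcongr
    have hg0 : 0 ≤ g s := by positivity
    have h1 : (volume (Q s \ E)).toReal ≤ (volume (Q s' \ E)).toReal :=
      ENNReal.toReal_mono (hfin' s' hs') (measure_mono (Set.sdiff_subset_sdiff_left hsub))
    have h2 : volume (Q s' \ E) ≤ volume (Q s \ E) + ENNReal.ofReal (g s' - g s) := by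
      calc volume (Q s' \ E) ≤ volume ((Q s \ E) ∪ (Q s' \ Q s)) := by
            refine measure_mono ?_
            rintro y ⟨hy, hyE⟩
            by_cases h : y ∈ Q s
            · exact Or.inl ⟨h, hyE⟩
            · exact Or.inr ⟨hy, h⟩
        _ ≤ volume (Q s \ E) + volume (Q s' \ Q s) := measure_union_le _ _
        _ = volume (Q s \ E) + ENNReal.ofReal (g s' - g s) := by
            rw [measure_sdiff hsub Metric.isClosed_closedBall.nullMeasurableSet (hfin s hs),
              hQ s hs, hQ s' hs', ENNReal.ofReal_sub _ hg0]
    have h3 : (volume (Q s' \ E)).toReal ≤ (volume (Q s \ E)).toReal + (g s' - g s) := by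
      have := ENNReal.toReal_mono (by have := hfin' s hs; finiteness) h2
      rwa [ENNReal.toReal_add (hfin' s hs) (by finiteness),
        ENNReal.toReal_ofReal (by linarith)] at this
    rw [Real.dist_eq, Real.dist_eq, abs_of_nonpos (by linarith), abs_of_nonpos (by linarith)]
    linarith
  have hgc : ContinuousOn g (Set.Ici 0) := by fun_prop
  rw [Metric.continuousOn_iff] at hgc ⊢
  intro s hs η hη
  obtain ⟨d, hd, h⟩ := hgc s hs η hη
  refine ⟨d, hd, fun s' hs' hlt => lt_of_le_of_lt ?_ (h s' hs' hlt)⟩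
  rcases le_total s s' with hle | hle
  · rw [dist_comm, dist_comm (g s')]; exact hdist s hs s' hle
  · exact hdist s' hs' s hle

/-- Almost every point of `E` in a cube which is not almost filled by `E` lies in a smaller cube in
which `E` has a prescribed density. -/
lemma ae_exists_closedBall_volume_diff_eq {n : ℕ} {δ : ℝ} (hδ0 : 0 < δ)
    {E : Set (Fin n → ℝ)} (hE : MeasurableSet E) {w : Fin n → ℝ} {r : ℝ} (hr : 0 < r)
    (h : ENNReal.ofReal δ * volume (Metric.closedBall w r) ≤
      volume (Metric.closedBall w r \ E)) :
    ∀ᵐ x ∂volume.restrict E, x ∈ Metric.closedBall w r →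
      ∃ w' r', 0 < r' ∧ r' ≤ r ∧ x ∈ Metric.closedBall w' r' ∧
        Metric.closedBall w' r' ⊆ Metric.closedBall w r ∧
        volume (Metric.closedBall w' r' \ E) =
          ENNReal.ofReal δ * volume (Metric.closedBall w' r') := by
  filter_upwards [IsUnifLocDoublingMeasure.ae_tendsto_measure_inter_div volume E 1] with x hx hxR
  set c : ℝ → (Fin n → ℝ) := fun s => AffineMap.lineMap x w s with hc
  set Q : ℝ → Set (Fin n → ℝ) := fun s => Metric.closedBall (c s) (s * r) with hQdef
  have hxQ : ∀ s, 0 ≤ s → x ∈ Q s := fun s hs => by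
    simp only [Q, c, Metric.mem_closedBall]
    rw [dist_left_lineMap, Real.norm_of_nonneg hs]
    exact mul_le_mul_of_nonneg_left (Metric.mem_closedBall.1 hxR) hs
  have hfin : ∀ s, volume (Q s) ≠ ∞ := fun s => measure_closedBall_lt_top.ne
  have hlim := hx (l := nhdsWithin (0 : ℝ) (Set.Ioi 0)) c (fun s => s * r) (by
      refine tendsto_nhdsWithin_iff.2 ⟨?_, ?_⟩
      · have : Filter.Tendsto (fun s : ℝ => s * r) (nhds 0) (nhds (0 * r)) :=
          (continuous_mul_const r).tendsto 0
        rw [zero_mul] at this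
        exact this.mono_left nhdsWithin_le_nhds
      · filter_upwards [self_mem_nhdsWithin] with s hs
        exact mul_pos hs hr) (by
      filter_upwards [self_mem_nhdsWithin] with s hs
      rw [one_mul]
      exact hxQ s (le_of_lt hs))
  -- At a density point the missing proportion is at most `δ` for some small `s₀`, while it is at
  -- least `δ` at `s = 1`; the intermediate value theorem supplies equality in between.
  have hev := hlim.eventually (lt_mem_nhds (a := 1 - ENNReal.ofReal δ)
    (ENNReal.sub_lt_self (by simp) (by simp) (by simpa using hδ0)))
  obtain ⟨s₀, hs₀, hs0, hs1⟩ : ∃ s₀ : ℝ, 1 - ENNReal.ofReal δ <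
      volume (E ∩ Metric.closedBall (c s₀) (s₀ * r)) /
        volume (Metric.closedBall (c s₀) (s₀ * r)) ∧ 0 < s₀ ∧ s₀ < 1 :=
    (hev.and ((Filter.Eventually.and self_mem_nhdsWithin
      (nhdsWithin_le_nhds (Iio_mem_nhds one_pos))))).exists
  have hpos : ∀ s, 0 < s → 0 < volume (Q s) := fun s hs =>
    Metric.measure_closedBall_pos _ _ (by positivity)
  have hlt : volume (Q s₀ \ E) ≤ ENNReal.ofReal δ * volume (Q s₀) := by
    have h1 := (ENNReal.lt_div_iff_mul_lt (Or.inl (hpos s₀ hs0).ne') (Or.inl (hfin s₀))).1 hs₀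
    have h2 : volume (Q s₀ ∩ E) + volume (Q s₀ \ E) = volume (Q s₀) := measure_inter_add_sdiff _ hE
    rw [Set.inter_comm] at h2
    have h3 : volume (Q s₀) ≤ (1 - ENNReal.ofReal δ) * volume (Q s₀) +
        ENNReal.ofReal δ * volume (Q s₀) := by
      rw [← add_mul]
      calc volume (Q s₀) = 1 * volume (Q s₀) := (one_mul _).symm
        _ ≤ _ := by gcongr; exact le_tsub_add
    have hfi : volume (E ∩ Q s₀) ≠ ∞ :=
      ((measure_mono Set.inter_subset_right).trans_lt (hfin s₀).lt_top).ne
    refine (ENNReal.add_le_add_iff_left hfi).1 ?_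
    rw [h2]
    exact h3.trans (by gcongr)
  set f : ℝ → ℝ := fun s => (volume (Q s \ E)).toReal
  have hcont : ContinuousOn (fun s => f s - δ * (2 * (s * r)) ^ n) (Set.Icc s₀ 1) :=
    ((continuousOn_volume_lineMap_diff hr.le hxR E).mono
      (fun s hs => hs0.le.trans hs.1)).sub (by fun_prop)
  have hvol : ∀ s, 0 < s → δ * (2 * (s * r)) ^ n = (ENNReal.ofReal δ * volume (Q s)).toReal := by
    intro s hs
    simp only [Q]
    rw [Real.volume_pi_closedBall _ (by positivity), ENNReal.toReal_mul,
      ENNReal.toReal_ofReal hδ0.le, ENNReal.toReal_ofReal (by positivity), Fintype.card_fin]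
  have hfin' : ∀ s, volume (Q s \ E) ≠ ∞ := fun s =>
    ((measure_mono Set.sdiff_subset).trans_lt (hfin s).lt_top).ne
  have hQ1 : Q 1 = Metric.closedBall w r := by simp [Q, c]
  obtain ⟨s, hs, hs'⟩ := intermediate_value_Icc hs1.le hcont (show (0 : ℝ) ∈ _ by
    constructor
    · rw [hvol _ hs0, sub_nonpos]
      exact ENNReal.toReal_mono (by have := hfin s₀; finiteness) hlt
    · rw [hvol _ one_pos, sub_nonneg]
      refine ENNReal.toReal_mono (hfin' 1) ?_
      rw [hQ1]
      exact h)
  have hspos : 0 < s := hs0.trans_le hs.1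
  refine ⟨c s, s * r, by positivity, by nlinarith [hs.2], hxQ s hspos.le, ?_, ?_⟩
  · rw [← hQ1]
    exact closedBall_lineMap_subset hxR hs.2
  · beta_reduce at hs'
    rw [hvol s hspos] at hs'
    exact (ENNReal.toReal_eq_toReal_iff' (hfin' s) (by have := hfin s; finiteness)).1
      (sub_eq_zero.1 hs')

/-- If `E'` contains the cubes almost filled by `E`, then the density of `E'` in any other cube
exceeds that of `E` by a fixed factor. -/
theorem mul_volume_inter_closedBall_le {n : ℕ} {δ : ℝ} (hδ0 : 0 < δ)
    {E E' : Set (Fin n → ℝ)} (hE : MeasurableSet E)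
    (hEE' : ∀ w r, 0 < r → volume (Metric.closedBall w r \ E) <
      ENNReal.ofReal δ * volume (Metric.closedBall w r) → Metric.closedBall w r ⊆ E')
    {w : Fin n → ℝ} {r : ℝ} (hr : 0 < r)
    (h : ENNReal.ofReal δ * volume (Metric.closedBall w r) ≤
      volume (Metric.closedBall w r \ E)) :
    ENNReal.ofReal (1 + δ / (2 * 4 ^ n)) * volume (Metric.closedBall w r ∩ E) ≤
      volume (Metric.closedBall w r ∩ E') := by
  set R := Metric.closedBall w r with hR
  -- Half of `δ` is small enough that these subcubes lie in `E'`, yet leaves each a fixed proportion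
  -- outside `E` to be gained.
  have hδ2 : 0 < δ / 2 := by positivity
  let t : Set ((Fin n → ℝ) × ℝ) := {q | 0 < q.2 ∧ q.2 ≤ r ∧ Metric.closedBall q.1 q.2 ⊆ R ∧
    volume (Metric.closedBall q.1 q.2 \ E) =
      ENNReal.ofReal (δ / 2) * volume (Metric.closedBall q.1 q.2)}
  have hae := ae_exists_closedBall_volume_diff_eq hδ2 hE hr (le_trans (by gcongr; linarith) h)
  rw [ae_restrict_iff' hE] at hae
  have hcov : volume (R ∩ E) ≤ volume ((⋃ q ∈ t, Metric.closedBall q.1 q.2) ∩ E) := by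
    refine measure_mono_ae ?_
    filter_upwards [hae] with x hx hxRE
    obtain ⟨w', r', h1, h2, h3, h4, h5⟩ := hx hxRE.2 hxRE.1
    exact ⟨Set.mem_biUnion (show (w', r') ∈ t from ⟨h1, h2, h4, h5⟩) h3, hxRE.2⟩
  have htE' : ∀ q ∈ t, Metric.closedBall q.1 q.2 ⊆ E' := by
    rintro q ⟨h1, h2, h3, h4⟩
    refine hEE' _ _ h1 ?_
    rw [h4]
    refine ENNReal.mul_lt_mul_left (Metric.measure_closedBall_pos _ _ h1).ne'
      measure_closedBall_lt_top.ne ?_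
    exact (ENNReal.ofReal_lt_ofReal_iff hδ0).2 (by linarith)
  obtain ⟨u, hut, hdisj, hsub⟩ := Vitali.exists_disjoint_subfamily_covering_enlargement_closedBall
    t (fun q => q.1) (fun q => q.2) r (fun q hq => hq.2.1) 4 (by norm_num)
  have hucount : u.Countable := hdisj.countable_of_nonempty_interior fun q hq =>
    (Metric.nonempty_ball.2 (hut hq).1).mono Metric.ball_subset_interior_closedBall
  -- The fourfold enlargements of the disjoint cubes cover almost all of `R ∩ E`, and each cube
  -- gains `δ / 2` of its own volume, that is `δ / (2 * 4 ^ n)` of its enlargement's.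
  have hgain : ENNReal.ofReal (δ / (2 * 4 ^ n)) * volume (R ∩ E) ≤ volume ((R ∩ E') \ E) := by
    calc ENNReal.ofReal (δ / (2 * 4 ^ n)) * volume (R ∩ E)
        ≤ ENNReal.ofReal (δ / (2 * 4 ^ n)) *
            volume (⋃ q ∈ u, Metric.closedBall q.1 (4 * q.2)) := by
          refine mul_le_mul_right (hcov.trans (measure_mono ?_)) _
          refine Set.inter_subset_left.trans (Set.iUnion₂_subset fun q hq => ?_)
          obtain ⟨b, hb, hqb⟩ := hsub q hq
          exact hqb.trans (Set.subset_biUnion_of_mem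
            (u := fun q : (Fin n → ℝ) × ℝ => Metric.closedBall q.1 (4 * q.2)) hb)
      _ ≤ ENNReal.ofReal (δ / (2 * 4 ^ n)) *
            ∑' q : u, volume (Metric.closedBall q.1.1 (4 * q.1.2)) := by
          gcongr
          exact measure_biUnion_le _ hucount _
      _ = ∑' q : u, volume (Metric.closedBall q.1.1 q.1.2 \ E) := by
          rw [← ENNReal.tsum_mul_left]
          congr 1
          ext q
          rw [(hut q.2).2.2.2, volume_closedBall_mul _ q.1.1 (hut q.2).1.le (by norm_num),
            ← mul_assoc, ← ENNReal.ofReal_mul (by positivity)]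
          congr 2
          field_simp
      _ = volume (⋃ q ∈ u, Metric.closedBall q.1 q.2 \ E) := by
          rw [measure_biUnion hucount (fun p hp q hq hpq => (hdisj hp hq hpq).mono
            Set.sdiff_subset Set.sdiff_subset)
            fun q _ => Metric.isClosed_closedBall.measurableSet.diff hE]
      _ ≤ volume ((R ∩ E') \ E) := by
          refine measure_mono (Set.iUnion₂_subset fun q hq => ?_)
          exact Set.sdiff_subset_sdiff_left (Set.subset_inter (hut hq).2.2.1 (htE' q (hut hq)))
  -- `E ⊆ E'` is not assumed; the subcubes show that `E'` contains almost all of `R ∩ E`.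
  have hkeep : volume (R ∩ E) ≤ volume ((R ∩ E') ∩ E) := by
    refine measure_mono_ae ?_
    filter_upwards [hae] with x hx hxRE
    obtain ⟨w', r', h1, h2, h3, h4, h5⟩ := hx hxRE.2 hxRE.1
    exact ⟨⟨hxRE.1, htE' (w', r') ⟨h1, h2, h4, h5⟩ h3⟩, hxRE.2⟩
  rw [ENNReal.ofReal_add zero_le_one (by positivity), ENNReal.ofReal_one, add_mul, one_mul,
    ← measure_inter_add_sdiff (R ∩ E') hE]
  gcongr

/-! ### Cubes as sup-norm balls; basic properties of halo sets and the halo function -/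

lemma mem_cubes_iff {n : ℕ} {R : Set (Fin n → ℝ)} :
    R ∈ cubes n ↔ ∃ w r, 0 < r ∧ R = Metric.ball w r := by
  constructor
  · rintro ⟨a, l, hl, rfl⟩
    refine ⟨fun i => a i + l / 2, l / 2, by positivity, ?_⟩
    rw [ball_pi _ (by positivity)]
    simp only [Real.ball_eq_Ioo]
    congr! 3 <;> ring
  · rintro ⟨w, r, hr, rfl⟩
    refine ⟨fun i => w i - r, 2 * r, by positivity, ?_⟩
    rw [ball_pi _ hr]
    simp only [Real.ball_eq_Ioo]
    congr! 3; ring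

/-- Allows null-measurable sets to be replaced by measurable ones. -/
lemma haloSet_congr_ae {n : ℕ} (B : Set (Set (Fin n → ℝ))) (t : ℝ) {E F : Set (Fin n → ℝ)}
    (h : E =ᵐ[volume] F) : haloSet B t E = haloSet B t F := by
  have key : ∀ R : Set (Fin n → ℝ), ∫⁻ y in R, ‖E.indicator (fun _ => (1 : ℝ)) y‖ₑ =
      ∫⁻ y in R, ‖F.indicator (fun _ => (1 : ℝ)) y‖ₑ := fun R => by
    refine lintegral_congr_ae ((ae_restrict_of_ae (indicator_ae_eq_of_ae_eq_set (f := fun _ => (1 : ℝ)) h)).mono fun y hy => ?_)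
    simp only [hy]
  simp only [haloSet, maximalFunction, key]

lemma ball_ae_eq_closedBall {n : ℕ} (w : Fin n → ℝ) {r : ℝ} (hr : 0 < r) :
    Metric.ball w r =ᵐ[volume] Metric.closedBall w r :=
  ae_eq_of_subset_of_measure_ge Metric.ball_subset_closedBall
    (by rw [Real.volume_pi_ball w hr, Real.volume_pi_closedBall w hr.le])
    Metric.isOpen_ball.nullMeasurableSet measure_closedBall_lt_top.ne

/-- Sphere boundaries are null, so measures may use closed balls; membership of `x` must keep the
open ball. -/
lemma mem_haloSet_cubes_iff {n : ℕ} {t : ℝ} {E : Set (Fin n → ℝ)} (hE : MeasurableSet E)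
    {x : Fin n → ℝ} :
    x ∈ haloSet (cubes n) t E ↔ ∃ w r, 0 < r ∧ x ∈ Metric.ball w r ∧
      ENNReal.ofReal t * volume (Metric.closedBall w r) < volume (Metric.closedBall w r ∩ E) := by
  have hint : ∀ w r, 0 < r → (ENNReal.ofReal t <
      (∫⁻ y in Metric.ball w r, ‖E.indicator (fun _ => (1 : ℝ)) y‖ₑ) / volume (Metric.ball w r) ↔
      ENNReal.ofReal t * volume (Metric.closedBall w r) <
        volume (Metric.closedBall w r ∩ E)) := by
    intro w r hr
    have h1 : ∀ y, ‖E.indicator (fun _ => (1 : ℝ)) y‖ₑ = E.indicator 1 y := fun y => by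
      by_cases hy : y ∈ E <;> simp [hy]
    have hae := ball_ae_eq_closedBall w hr
    simp only [h1]
    rw [lintegral_indicator_one hE, Measure.restrict_apply hE, Set.inter_comm,
      measure_congr hae, measure_congr (hae.inter (ae_eq_refl E)),
      ENNReal.lt_div_iff_mul_lt (Or.inl (Metric.measure_closedBall_pos _ _ hr).ne')
        (Or.inl measure_closedBall_lt_top.ne)]
  simp only [haloSet, maximalFunction, Set.mem_ofPred_eq, lt_iSup_iff, mem_cubes_iff]
  constructor
  · rintro ⟨R, ⟨⟨w, r, hr, rfl⟩, hx⟩, h⟩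
    exact ⟨w, r, hr, hx, (hint w r hr).1 h⟩
  · rintro ⟨w, r, hr, hx, h⟩
    exact ⟨_, ⟨⟨w, r, hr, rfl⟩, hx⟩, (hint w r hr).2 h⟩

lemma haloFunction_le {n : ℕ} {a : ℝ} (ha : 1 < a) {C : ℝ≥0∞}
    (h : ∀ E : Set (Fin n → ℝ), MeasurableSet E → 0 < volume E → volume E < ∞ →
      volume (haloSet (cubes n) (1 / a) E) ≤ C * volume E) :
    haloFunction (cubes n) a ≤ C := by
  rw [haloFunction, if_neg (not_le.2 ha)]
  refine iSup₂_le fun E hE => ?_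
  obtain ⟨hm, h0, htop⟩ := hE
  have hEF := hm.toMeasurable_ae_eq
  rw [← haloSet_congr_ae _ _ hEF, ← measure_congr hEF]
  rw [← measure_congr hEF] at h0 htop
  exact ENNReal.div_le_of_le_mul (h _ (measurableSet_toMeasurable _ _) h0 htop)

lemma volume_haloSet_le {n : ℕ} {a : ℝ} (ha : 1 < a) {E : Set (Fin n → ℝ)}
    (hE : MeasurableSet E) (htop : volume E < ∞) :
    volume (haloSet (cubes n) (1 / a) E) ≤ haloFunction (cubes n) a * volume E := by
  rcases eq_or_ne (volume E) 0 with h0 | h0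
  · have : haloSet (cubes n) (1 / a) E = ∅ := by
      refine Set.eq_empty_of_forall_notMem fun x hx => ?_
      obtain ⟨w, r, -, -, h⟩ := (mem_haloSet_cubes_iff hE).1 hx
      rw [measure_mono_null Set.inter_subset_right h0] at h
      exact not_lt_zero h
    rw [this, measure_empty]
    exact zero_le
  · rw [← ENNReal.div_le_iff h0 htop.ne, haloFunction, if_neg (not_le.2 ha)]
    exact le_iSup₂ (f := fun (E : Set (Fin n → ℝ)) (_ : E ∈ {E : Set (Fin n → ℝ) |
      NullMeasurableSet E volume ∧ 0 < volume E ∧ volume E < ∞}) =>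
      volume (haloSet (cubes n) (1 / a) E) / volume E) E
      ⟨hE.nullMeasurableSet, pos_iff_ne_zero.2 h0, htop⟩

/-- Tested on a single cube, which lies in its own halo set. -/
lemma one_le_haloFunction {n : ℕ} {a : ℝ} (ha : 1 < a) : 1 ≤ haloFunction (cubes n) a := by
  have hm : MeasurableSet (Metric.ball (0 : Fin n → ℝ) 1) := Metric.isOpen_ball.measurableSet
  have hfin : volume (Metric.ball (0 : Fin n → ℝ) 1) < ∞ := measure_ball_lt_top
  have hpos : 0 < volume (Metric.ball (0 : Fin n → ℝ) 1) := Metric.measure_ball_pos _ _ one_pos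
  refine (ENNReal.mul_le_mul_iff_left hpos.ne' hfin.ne).1 ?_
  rw [one_mul]
  refine le_trans (measure_mono fun x hx => ?_) (volume_haloSet_le ha hm hfin)
  refine (mem_haloSet_cubes_iff hm).2 ⟨0, 1, one_pos, hx, ?_⟩
  rw [Set.inter_eq_right.2 Metric.ball_subset_closedBall,
    measure_congr (ball_ae_eq_closedBall _ one_pos)]
  conv_rhs => rw [← one_mul (volume _)]
  refine ENNReal.mul_lt_mul_left (Metric.measure_closedBall_pos _ _ one_pos).ne'
    measure_closedBall_lt_top.ne ?_
  rw [ENNReal.ofReal_lt_one, div_lt_one (by linarith)]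
  exact ha

lemma haloFunction_of_le_one {n : ℕ} {a : ℝ} (ha : a ≤ 1) :
    haloFunction (cubes n) a = ENNReal.ofReal a := by
  rw [haloFunction, if_pos ha]

lemma monotone_haloFunction (n : ℕ) : Monotone (haloFunction (cubes n)) := by
  intro a b hab
  rcases le_or_gt b 1 with hb | hb
  · rw [haloFunction_of_le_one hb, haloFunction_of_le_one (hab.trans hb)]
    exact ENNReal.ofReal_le_ofReal hab
  rcases le_or_gt a 1 with ha | ha
  · rw [haloFunction_of_le_one ha]
    exact (ENNReal.ofReal_le_one.2 ha).trans (one_le_haloFunction hb)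
  refine haloFunction_le ha fun E hE _ htop => ?_
  refine (measure_mono fun x hx => ?_).trans (volume_haloSet_le hb hE htop)
  refine lt_of_le_of_lt (ENNReal.ofReal_le_ofReal ?_) (show _ < _ from hx)
  exact one_div_le_one_div_of_le (by linarith) hab

/-! ### Growth and finiteness of the halo function -/

/-- Growth of the halo function under a small dilation of its argument. -/
theorem haloFunction_mul_le {n : ℕ} {ε : ℝ≥0} (hε0 : 0 < ε) (hε : ε ≤ 1 / 4) {a : ℝ}
    (ha : 1 ≤ a) :
    haloFunction (cubes n) ((1 + (ε : ℝ) ^ n / (2 * 4 ^ n)) * a) ≤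
      (1 + 4 * ε) ^ n * haloFunction (cubes n) a := by
  set δ : ℝ := (ε : ℝ) ^ n with hδ
  have hδ0 : 0 < δ := by positivity
  set κ : ℝ := 1 + δ / (2 * 4 ^ n) with hκ
  have hκ1 : 1 < κ := by
    have : 0 < δ / (2 * 4 ^ n) := by positivity
    linarith
  have hκδ : κ ≤ 1 + δ := by
    have : (1 : ℝ) ≤ 2 * 4 ^ n := by
      have := one_le_pow₀ (M₀ := ℝ) (n := n) (show (1 : ℝ) ≤ 4 by norm_num)
      linarith
    have := div_le_self hδ0.le this
    linarith
  have hb : 1 < κ * a := by nlinarith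
  refine haloFunction_le hb fun E hE h0 htop => ?_
  obtain ⟨E', hE', hvol, hfull⟩ := exists_halo hε hE
  have hδε : (ε : ℝ≥0∞) ^ n = ENNReal.ofReal δ := by
    rw [hδ, ENNReal.ofReal_pow ε.coe_nonneg, ENNReal.ofReal_coe_nnreal]
  have hfull' : ∀ w r, 0 < r → volume (Metric.closedBall w r \ E) <
      ENNReal.ofReal δ * volume (Metric.closedBall w r) → Metric.closedBall w r ⊆ E' := by
    intro w r hr h
    rw [closedBall_pi_eq_Icc w hr.le] at h ⊢
    exact hfull _ _ (by rwa [hδε])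
  -- At `a = 1` the halo function is 1 by definition and not a supremum, so the halo set is placed
  -- directly inside `E'`: density above `1 / κ` means a missing proportion below `δ`, since `κ ≤ 1
  -- + δ` gives `1 / κ + δ ≥ 1`.
  rcases ha.eq_or_lt with rfl | ha
  · rw [haloFunction_of_le_one le_rfl, ENNReal.ofReal_one, mul_one ((1 + 4 * (ε : ℝ≥0∞)) ^ n)]
    refine (measure_mono fun x hx => ?_).trans hvol
    obtain ⟨w, r, hr, hxw, h⟩ := (mem_haloSet_cubes_iff hE).1 hx
    refine hfull' w r hr ?_ (Metric.ball_subset_closedBall hxw)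
    set R := Metric.closedBall w r
    have hsum : volume (R ∩ E) + volume (R \ E) = volume R := measure_inter_add_sdiff _ hE
    have hRtop : volume R ≠ ∞ := measure_closedBall_lt_top.ne
    have h1 : volume (R ∩ E) ≠ ∞ := (measure_mono Set.inter_subset_left).trans_lt
      hRtop.lt_top |>.ne
    have h2 : volume (R \ E) ≠ ∞ := (measure_mono Set.sdiff_subset).trans_lt hRtop.lt_top |>.ne
    have hle : volume R ≤ ENNReal.ofReal (1 / (κ * 1)) * volume R +
        ENNReal.ofReal δ * volume R := by
      rw [← add_mul, ← ENNReal.ofReal_add (by positivity) hδ0.le]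
      conv_lhs => rw [← one_mul (volume R)]
      gcongr
      rw [ENNReal.one_le_ofReal, mul_one, ← sub_le_iff_le_add]
      rw [le_div_iff₀ (by linarith)]
      nlinarith
    by_contra! hcon
    have := ENNReal.add_lt_add_of_lt_of_le (by finiteness) h hcon
    rw [hsum] at this
    exact absurd this (not_lt.2 hle)
  · have hE'top : volume E' < ∞ := hvol.trans_lt (by finiteness)
    calc volume (haloSet (cubes n) (1 / (κ * a)) E)
        ≤ volume (haloSet (cubes n) (1 / a) E') := by
          refine measure_mono fun x hx => ?_
          obtain ⟨w, r, hr, hxw, h⟩ := (mem_haloSet_cubes_iff hE).1 hx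
          refine (mem_haloSet_cubes_iff hE').2 ⟨w, r, hr, hxw, ?_⟩
          -- An almost full cube lies in `E'`, with density `1 > 1 / a`; in any other cube the
          -- density grows by the factor `κ`.
          rcases lt_or_ge (volume (Metric.closedBall w r \ E))
            (ENNReal.ofReal δ * volume (Metric.closedBall w r)) with hlt | hge
          · rw [Set.inter_eq_left.2 (hfull' w r hr hlt)]
            conv_rhs => rw [← one_mul (volume _)]
            refine ENNReal.mul_lt_mul_left (Metric.measure_closedBall_pos _ _ hr).ne'
              measure_closedBall_lt_top.ne ?_
            rw [ENNReal.ofReal_lt_one, div_lt_one (by linarith)]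
            exact ha
          · refine lt_of_lt_of_le ?_ (mul_volume_inter_closedBall_le hδ0 hE hfull' hr hge)
            rw [← hκ]
            have h1 : ENNReal.ofReal (1 / a) =
                ENNReal.ofReal κ * ENNReal.ofReal (1 / (κ * a)) := by
              rw [← ENNReal.ofReal_mul (by linarith)]
              congr 1
              field_simp
            rw [h1, mul_assoc]
            exact (ENNReal.mul_lt_mul_iff_right (by simp; linarith) (by simp)).2 h
      _ ≤ haloFunction (cubes n) a * volume E' := volume_haloSet_le ha hE' hE'top
      _ ≤ haloFunction (cubes n) a * ((1 + 4 * ε) ^ n * volume E) := by gcongr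
      _ = _ := by ring

/-- The growth bound with `ε = 1 / 4`, iterated from the value 1 at 1, gives finiteness at all
powers of `κ`; monotonicity does the rest. -/
theorem haloFunction_cubes_ne_top (n : ℕ) (a : ℝ) : haloFunction (cubes n) a ≠ ∞ := by
  set κ : ℝ := 1 + ((1 / 4 : ℝ≥0) : ℝ) ^ n / (2 * 4 ^ n)
  have hκ : 1 < κ := by
    have : 0 < ((1 / 4 : ℝ≥0) : ℝ) ^ n / (2 * 4 ^ n) := by positivity
    linarith
  have hpow : ∀ k : ℕ, haloFunction (cubes n) (κ ^ k) ≠ ∞ := by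
    intro k
    induction k with
    | zero => rw [pow_zero, haloFunction_of_le_one le_rfl]; simp
    | succ k ih =>
      rw [pow_succ']
      exact ((haloFunction_mul_le (by positivity) le_rfl (one_le_pow₀ hκ.le)).trans_lt
        (by finiteness)).ne
  obtain ⟨k, hk⟩ := pow_unbounded_of_one_lt a hκ
  exact ((monotone_haloFunction n hk.le).trans_lt (hpow k).lt_top).ne

/-! ### The Hölder estimate -/

lemma one_add_pow_le_one_add_two_pow_mul {u : ℝ} (hu0 : 0 ≤ u) (hu1 : u ≤ 1) (n : ℕ) :
    (1 + u) ^ n ≤ 1 + 2 ^ n * u := by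
  -- The chord bound on `[0, 1]`; unlike the weaker stated form, it is preserved by the induction.
  have h : (1 + u) ^ n ≤ 1 + (2 ^ n - 1) * u := by
    induction n with
    | zero => simp
    | succ k ih =>
      have h1 : (1 : ℝ) ≤ 2 ^ k := one_le_pow₀ one_le_two
      have h2 : u * u ≤ u := mul_le_of_le_one_right hu0 hu1
      rw [pow_succ, pow_succ]
      nlinarith [mul_le_mul_of_nonneg_right ih (show 0 ≤ 1 + u by linarith),
        mul_le_mul_of_nonneg_left h2 (sub_nonneg.2 h1)]
  linarith

lemma toReal_haloFunction_sub_le {n : ℕ} (hn : 1 ≤ n) {x y A : ℝ} (hx : 1 ≤ x) (hxy : x ≤ y)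
    (hyA : y ≤ A) :
    (haloFunction (cubes n) y).toReal - (haloFunction (cubes n) x).toReal ≤
      2 ^ n * 4 * (haloFunction (cubes n) A).toReal * (2 * 4 ^ n) ^ (1 / (n : ℝ)) *
        (y - x) ^ (1 / (n : ℝ)) := by
  set f : ℝ → ℝ := fun a => (haloFunction (cubes n) a).toReal
  have hf : Monotone f := fun a b hab =>
    ENNReal.toReal_mono (haloFunction_cubes_ne_top n b) (monotone_haloFunction n hab)
  have hf0 : ∀ a, 0 ≤ f a := fun a => ENNReal.toReal_nonneg
  change f y - f x ≤ 2 ^ n * 4 * f A * (2 * 4 ^ n) ^ (1 / (n : ℝ)) * (y - x) ^ (1 / (n : ℝ))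
  rcases hxy.eq_or_lt with rfl | hlt
  · rw [sub_self]
    have := hf0 A
    positivity
  -- Chosen so that `ε ^ n / (2 * 4 ^ n) = y - x`; as `x ≥ 1`, the dilated point `(1 + (y - x)) * x`
  -- is at least `y`.
  set ε : ℝ := ((2 * 4 ^ n) * (y - x)) ^ (1 / (n : ℝ)) with hε
  have hyx : 0 < y - x := sub_pos.2 hlt
  have hε0 : 0 < ε := by positivity
  rw [mul_assoc (2 ^ n * 4 * f A), ← Real.mul_rpow (by positivity) hyx.le, ← hε]
  have h2n : (1 : ℝ) ≤ 2 ^ n := one_le_pow₀ one_le_two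
  rcases le_or_gt ε (1 / 4) with hε4 | hε4
  · have hεn : ε ^ n = (2 * 4 ^ n) * (y - x) := by
      rw [hε, one_div, Real.rpow_inv_natCast_pow (by positivity) (by omega)]
    have hstep : f y ≤ (1 + 4 * ε) ^ n * f x := by
      obtain ⟨e, he⟩ : ∃ e : ℝ≥0, (e : ℝ) = ε := ⟨ε.toNNReal, Real.coe_toNNReal _ hε0.le⟩
      have he4 : e ≤ 1 / 4 := by
        rw [← NNReal.coe_le_coe, he]
        exact_mod_cast hε4
      have h1 := haloFunction_mul_le (n := n) (NNReal.coe_pos.1 (he ▸ hε0)) he4 hx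
      have h2 := ENNReal.toReal_mono (by have := haloFunction_cubes_ne_top n x; finiteness) h1
      rw [ENNReal.toReal_mul, ENNReal.toReal_pow,
        ENNReal.toReal_add (by finiteness) (by finiteness), ENNReal.toReal_mul] at h2
      simp only [ENNReal.toReal_one, ENNReal.toReal_ofNat, ENNReal.coe_toReal, he] at h2
      refine (hf ?_).trans h2
      rw [hεn, mul_div_cancel_left₀ _ (by positivity)]
      nlinarith
    have hbern := one_add_pow_le_one_add_two_pow_mul (u := 4 * ε) (by positivity) (by linarith) n
    calc f y - f x ≤ (1 + 2 ^ n * (4 * ε)) * f x - f x := by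
          have := mul_le_mul_of_nonneg_right hbern (hf0 x)
          linarith
      _ = 2 ^ n * 4 * f x * ε := by ring
      _ ≤ 2 ^ n * 4 * f A * ε := by
          have := hf (hxy.trans hyA)
          gcongr
  -- For large `ε` the trivial bound by `f A` suffices, because `1 ≤ 4 * ε`.
  · calc f y - f x ≤ f A := by linarith [hf hyA, hf0 x]
      _ = 1 * f A * 1 := by ring
      _ ≤ 2 ^ n * f A * (4 * ε) := by
          have := hf0 A
          gcongr
          linarith
      _ = 2 ^ n * 4 * f A * ε := by ring

lemma self_le_rpow_one_div {n : ℕ} (hn : 1 ≤ n) {u : ℝ} (h0 : 0 ≤ u) (h1 : u ≤ 1) :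
    u ≤ u ^ (1 / (n : ℝ)) :=
  Real.self_le_rpow_of_le_one h0 h1 (by
    rw [div_le_one (by positivity)]
    exact_mod_cast hn)

lemma exists_toReal_haloFunction_sub_le {n : ℕ} (hn : 1 ≤ n) {A : ℝ} :
    ∃ C : ℝ≥0, ∀ x y, 0 ≤ x → x ≤ y → y ≤ A →
      (haloFunction (cubes n) y).toReal - (haloFunction (cubes n) x).toReal ≤
        C * (y - x) ^ (1 / (n : ℝ)) := by
  obtain ⟨D, hD⟩ : ∃ D : ℝ≥0, (D : ℝ) = 2 ^ n * 4 * (haloFunction (cubes n) A).toReal *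
      (2 * 4 ^ n) ^ (1 / (n : ℝ)) := ⟨⟨_, by positivity⟩, rfl⟩
  have hval : ∀ a : ℝ, 0 ≤ a → a ≤ 1 → (haloFunction (cubes n) a).toReal = a := fun a h0 h1 => by
    rw [haloFunction_of_le_one h1, ENNReal.toReal_ofReal h0]
  -- The extra 1 accounts for `[0, 1]`, where the halo function is the identity; a pair straddling 1
  -- is split there.
  refine ⟨D + 1, fun x y hx hxy hyA => ?_⟩
  have hD0 : (0 : ℝ) ≤ D := D.2
  have hp : 0 ≤ (y - x) ^ (1 / (n : ℝ)) := Real.rpow_nonneg (by linarith) _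
  push_cast
  rw [add_mul, one_mul]
  rcases le_total y 1 with hy | hy
  · rw [hval y (hx.trans hxy) hy, hval x hx (hxy.trans hy)]
    have := self_le_rpow_one_div hn (u := y - x) (by linarith) (by linarith)
    nlinarith [mul_nonneg hD0 hp]
  rcases le_total x 1 with hx1 | hx1
  · have h1 := toReal_haloFunction_sub_le hn le_rfl hy hyA
    rw [← hD, hval 1 zero_le_one le_rfl] at h1
    rw [hval x hx hx1]
    have h2 := self_le_rpow_one_div hn (u := 1 - x) (by linarith) (by linarith)
    have h3 : (1 - x) ^ (1 / (n : ℝ)) ≤ (y - x) ^ (1 / (n : ℝ)) :=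
      Real.rpow_le_rpow (by linarith) (by linarith) (by positivity)
    have h4 : (y - 1) ^ (1 / (n : ℝ)) ≤ (y - x) ^ (1 / (n : ℝ)) :=
      Real.rpow_le_rpow (by linarith) (by linarith) (by positivity)
    have := mul_le_mul_of_nonneg_left h4 hD0
    linarith
  · have h1 := toReal_haloFunction_sub_le hn hx1 hxy hyA
    rw [← hD] at h1
    linarith

end GeomMax

theorem corollaryc4 (n : ℕ) (hn : 1 ≤ n) :
    (∀ a : ℝ, 0 ≤ a → GeomMax.haloFunction (GeomMax.cubes n) a ≠ ∞) ∧
      GeomMax.HolderClass (1 / (n : ℝ≥0)) (Set.Ici 0)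
        (fun a => (GeomMax.haloFunction (GeomMax.cubes n) a).toReal) := by
  refine ⟨fun a _ => GeomMax.haloFunction_cubes_ne_top n a, fun K hK hK0 => ?_⟩
  obtain ⟨A, hA⟩ := hK.bddAbove
  obtain ⟨C, hC⟩ := GeomMax.exists_toReal_haloFunction_sub_le hn (A := A)
  have hmono : Monotone fun a => (GeomMax.haloFunction (GeomMax.cubes n) a).toReal :=
    fun a b hab => ENNReal.toReal_mono (GeomMax.haloFunction_cubes_ne_top n b)
      (GeomMax.monotone_haloFunction n hab)
  have key : ∀ x ∈ K, ∀ y ∈ K, x ≤ y →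
      edist (GeomMax.haloFunction (GeomMax.cubes n) x).toReal
        (GeomMax.haloFunction (GeomMax.cubes n) y).toReal ≤
      C * edist x y ^ ((1 / (n : ℝ≥0) : ℝ≥0) : ℝ) := by
    intro x hx y hy hxy
    have h := hC x y (hK0 hx) hxy (hA hy)
    have hm := hmono hxy
    rw [edist_dist, edist_dist, dist_comm, dist_comm x, Real.dist_eq, Real.dist_eq,
      abs_of_nonneg (sub_nonneg.2 hm), abs_of_nonneg (sub_nonneg.2 hxy),
      ENNReal.ofReal_rpow_of_nonneg (sub_nonneg.2 hxy) (NNReal.coe_nonneg _),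
      ← ENNReal.ofReal_coe_nnreal (p := C), ← ENNReal.ofReal_mul C.coe_nonneg]
    refine ENNReal.ofReal_le_ofReal (h.trans_eq ?_)
    push_cast
    rfl
  refine ⟨C, fun x hx y hy => ?_⟩
  rcases le_total x y with hxy | hxy
  · exact key x hx y hy hxy
  · rw [edist_comm, edist_comm x]
    exact key y hy x hx hxy
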